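/- Let $\mathbb F$ be a field, let $S_1,\dots,S_N$ be finite totally ordered sets, let $P = S_1\times\cdots\times S_N$ carry the product partial order, regarded as a category, and let $F\colon P\to \mathsf{Vec}_{\mathbb F}$ be a functor. Assume that $F$ is pointwise finite-dimensional, i.e. $F(x)$ is finite-dimensional for every $x\in P$, and that $F$ is of bidegree $1$, i.e. $F$ sends every square in $P$ that is both a pullback and a pushout in $P$ (equivalently, every square $x\wedge y\le x,y\le x\vee y$) to a square in $\mathsf{Vec}_{\mathbb F}$ that is both a pullback (degree $1$) and a pushout (codegree $1$). Then $F$ is interval decomposable: there is a family $(I_b)_{b\in B}$ of intervals in $P$, possibly with repetitions, such that $$F\;\cong\;\bigoplus_{b\in B}\mathbb F_{I_b}$$ as functors $P\to\mathsf{Vec}_{\mathbb F}$. Here an interval in $P$ is a nonempty subset $I\subseteq P$ such that $x\le z\le y$ with $x,y\in I$ implies $z\in I$, and such that any two points of $I$ are connected by a finite zigzag of order relations between points of $I$. The interval module $\mathbb F_I$ has $\mathbb F_I(x)=\mathbb F$ for $x\in I$ and $\mathbb F_I(x)=0$ otherwise, and $\mathbb F_I(x\le y)$ is the identity of $\mathbb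 F$ if $x,y\in I$ and zero otherwise. -/

import Mathlib

open CategoryTheory CategoryTheory.Limits

universe u v w

/-- A persistence module over a poset `P`: a functor from `P`, regarded as a category through its
order, to vector spaces over `K`. (On a product of posets this is the category of the product
partial order.) -/
abbrev PersistenceModule (K : Type u) [Field K] (P : Type v) [PartialOrder P] :
    Type (max v (u + 1)) :=
  P ⥤ ModuleCat.{u} K

namespace PersistenceModule

variable {K : Type u} [Field K] {P : Type v} [PartialOrder P]

/-- Pointwise finite-dimensional. -/
def IsPFD (F : PersistenceModule K P) : Prop :=
  ∀ x : P, FiniteDimensional K (F.obj x)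

/-- Degree 1: bicartesian 2-cubes (squares) in `P` are sent to cartesian 2-cubes (pullbacks).
A 2-cube has no other face of dimension at least two, so for a square "strongly bicartesian" means
bicartesian in the category `P`. -/
def IsDegreeOne (F : PersistenceModule K P) : Prop :=
  ∀ ⦃a x y b : P⦄ (f : a ⟶ x) (g : a ⟶ y) (h : x ⟶ b) (i : y ⟶ b),
    BicartesianSq f g h i → IsPullback (F.map f) (F.map g) (F.map h) (F.map i)

/-- Codegree 1: bicartesian 2-cubes (squares) in `P` are sent to cocartesian 2-cubes (pushouts). -/
def IsCodegreeOne (F : PersistenceModule K P) : Prop :=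
  ∀ ⦃a x y b : P⦄ (f : a ⟶ x) (g : a ⟶ y) (h : x ⟶ b) (i : y ⟶ b),
    BicartesianSq f g h i → IsPushout (F.map f) (F.map g) (F.map h) (F.map i)

/-- Bidegree 1: both degree 1 and codegree 1. -/
def IsBidegreeOne (F : PersistenceModule K P) : Prop :=
  F.IsDegreeOne ∧ F.IsCodegreeOne

/-- An interval in `P`: a nonempty convex subset any two points of which are joined, inside the
subset, by a finite zigzag of order relations. -/
structure IsInterval (I : Set P) : Prop where
  nonempty : I.Nonempty
  ordConnected : I.OrdConnected
  zigzag : ∀ x y : I, Relation.ReflTransGen (fun a b : I => a ≤ b ∨ b ≤ a) x y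

open Classical in
/-- The interval module of a convex set `I`. Its value at `x` is the space of functions from the
proofs of `x ∈ I` to `K`, that is, `K` if `x ∈ I` and `0` otherwise; the structure map from `x` to
`y` is the identity of `K` if `x, y ∈ I` and zero otherwise. -/
noncomputable def intervalModule (K : Type u) [Field K] (I : Set P) (hI : I.OrdConnected) :
    PersistenceModule K P where
  obj x := ModuleCat.of K (PLift (x ∈ I) → K)
  map {x y} _ := ModuleCat.ofHom
    { toFun := fun s _ => if hx : x ∈ I then s ⟨hx⟩ else 0
      map_add' := fun s t => by ext; by_cases hx : x ∈ I <;> simp [hx]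
      map_smul' := fun c s => by ext; by_cases hx : x ∈ I <;> simp [hx] }
  map_id x := by
    refine ModuleCat.hom_ext (LinearMap.ext fun s => funext fun hx => ?_)
    simp [hx.down]
  map_comp {x y z} f g := by
    refine ModuleCat.hom_ext (LinearMap.ext fun s => funext fun hz => ?_)
    by_cases hx : x ∈ I
    · have hy : y ∈ I := hI.out hx hz.down ⟨leOfHom f, leOfHom g⟩
      simp [hx, hy]
    · simp [hx]

/-- `F` is isomorphic to a direct sum (coproduct of persistence modules) of a family of interval
modules, in which an interval may occur repeatedly. -/
def IsIntervalDecomposable (F : PersistenceModule K P) : Prop :=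
  ∃ (B : Type u) (I : B → Set P) (hI : ∀ b, IsInterval (I b)),
    Nonempty (F ≅ ∐ fun b => intervalModule K (I b) (hI b).ordConnected)

end PersistenceModule

/-! It suffices to split one interval module off a nonzero `F`: the complement is again exact on
squares, being a retract, and induction on total dimension finishes. A vector `v` in `F a` that dies
outside `Icc a b`, and a functional on `F b` that kills everything coming from outside `Icc a b` but
not the image of `v`, split off the module of `Icc a b`.

Exactness reduces the search for such a pair to the coordinate axes through `⊥`. If `F ⊥ = 0`, some
axis carries a nonzero vector; take the first level `s` where one occurs and the last level `m` it
reaches, and use the slab between levels `s` and `m` (`hasIccRetract_of_axis`). If a vector at `⊥`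
survives to `⊤`, the whole grid splits off. Otherwise a nonzero vector at `⊥` dies along some axis,
and the slab up to its last level splits off (`hasIccRetract_of_trans_axis_eq_zero`). -/

namespace PersistenceModule

/-! ### Modules over arbitrary posets: exactness, retracts, splitting -/

section General

variable {K : Type u} [Field K] {P : Type v}

/-- The value of a persistence module at a point of `P`. On a product of posets, unlike `F.obj x`,
it is unambiguous that `P` is a category through its order and not as a product of categories. -/
abbrev stalk [PartialOrder P] (F : PersistenceModule K P) (x : P) : ModuleCat.{u} K :=
  F.obj x

/-- The structure map of a persistence module along an order relation. -/
noncomputable def trans [PartialOrder P] (F : PersistenceModule K P) {x y : P} (h : x ≤ y) :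
    F.obj x →ₗ[K] F.obj y :=
  (F.map (homOfLE h)).hom

section Trans

variable [PartialOrder P] {F G : PersistenceModule K P}

lemma trans_refl {x : P} (h : x ≤ x) (v : F.obj x) : F.trans h v = v := by
  simp [trans]

lemma trans_trans {x y z : P} (h : x ≤ y) (h' : y ≤ z) (v : F.obj x) :
    F.trans h' (F.trans h v) = F.trans (h.trans h') v := by
  have : F.map (homOfLE (h.trans h')) = F.map (homOfLE h) ≫ F.map (homOfLE h') := by
    rw [← F.map_comp]; rfl
  simp [trans, this]

lemma hom_app_trans (α : F ⟶ G) {x y : P} (h : x ≤ y) (v : F.obj x) :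
    (α.app y).hom (F.trans h v) = G.trans h ((α.app x).hom v) := by
  simp [trans]

lemma app_retract {i : F ⟶ G} {r : G ⟶ F} (h : i ≫ r = 𝟙 F) (x : P) (v : F.obj x) :
    (r.app x).hom ((i.app x).hom v) = v := by
  have := congrArg (fun f => (f.app x).hom v) h
  simpa using this

end Trans

/-- Elementwise form of sending every square `x ⊓ y ≤ x, y ≤ x ⊔ y` to a bicartesian square. -/
structure IsExactOnSquares [Lattice P] (F : PersistenceModule K P) : Prop where
  inj : ∀ {a x y : P} (hx : a ≤ x) (hy : a ≤ y), x ⊓ y = a →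
    ∀ v : F.obj a, F.trans hx v = 0 → F.trans hy v = 0 → v = 0
  lift : ∀ {a x y b : P} (hx : a ≤ x) (hy : a ≤ y) (hx' : x ≤ b) (hy' : y ≤ b),
    x ⊓ y = a → x ⊔ y = b → ∀ (p : F.obj x) (q : F.obj y), F.trans hx' p = F.trans hy' q →
      ∃ w : F.obj a, F.trans hx w = p ∧ F.trans hy w = q
  surj : ∀ {x y b : P} (hx : x ≤ b) (hy : y ≤ b), x ⊔ y = b →
    ∀ z : F.obj b, ∃ (p : F.obj x) (q : F.obj y), F.trans hx p + F.trans hy q = z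

lemma bicartesianSq_of_inf_sup [Lattice P] {a x y b : P} (hx : a ≤ x) (hy : a ≤ y) (hx' : x ≤ b)
    (hy' : y ≤ b) (ha : x ⊓ y = a) (hb : x ⊔ y = b) :
    BicartesianSq (homOfLE hx) (homOfLE hy) (homOfLE hx') (homOfLE hy') where
  w := rfl
  isLimit' := ⟨PullbackCone.IsLimit.mk _
    (fun s => homOfLE (ha ▸ le_inf (leOfHom s.fst) (leOfHom s.snd)))
    (fun _ => rfl) (fun _ => rfl) (fun _ _ _ _ => rfl)⟩
  isColimit' := ⟨PushoutCocone.IsColimit.mk _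
    (fun s => homOfLE (hb ▸ sup_le (leOfHom s.inl) (leOfHom s.inr)))
    (fun _ => rfl) (fun _ => rfl) (fun _ _ _ _ => rfl)⟩

lemma IsBidegreeOne.isExactOnSquares [Lattice P] {F : PersistenceModule K P}
    (hF : F.IsBidegreeOne) : F.IsExactOnSquares where
  inj {a x y} hx hy ha v hvx hvy := by
    have sq := (hF.1 _ _ _ _ (bicartesianSq_of_inf_sup hx hy le_sup_left le_sup_right ha rfl)).map
      (forget (ModuleCat K))
    exact Types.ext_of_isPullback sq (hvx.trans (map_zero (F.trans hx)).symm)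
      (hvy.trans (map_zero (F.trans hy)).symm)
  lift {a x y b} hx hy hx' hy' ha hb p q h := by
    have sq := (hF.1 _ _ _ _ (bicartesianSq_of_inf_sup hx hy hx' hy' ha hb)).map
      (forget (ModuleCat K))
    exact Types.exists_of_isPullback sq p q h
  surj {x y b} hx hy hb z := by
    have sq := hF.2 _ _ _ _ (bicartesianSq_of_inf_sup inf_le_left inf_le_right hx hy rfl hb)
    -- The quotient map by `W` vanishes on both legs of the pushout, hence is zero.
    let W := LinearMap.range (F.trans hx) ⊔ LinearMap.range (F.trans hy)
    have h0 : ModuleCat.ofHom W.mkQ = 0 := by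
      refine sq.hom_ext ?_ ?_
      · ext p
        exact (Submodule.Quotient.mk_eq_zero W).2 (Submodule.mem_sup_left ⟨p, rfl⟩)
      · ext p
        exact (Submodule.Quotient.mk_eq_zero W).2 (Submodule.mem_sup_right ⟨p, rfl⟩)
    have hz : z ∈ W := (Submodule.Quotient.mk_eq_zero W).1 (congrArg (fun f => f.hom z) h0)
    obtain ⟨_, ⟨p, rfl⟩, _, ⟨q, rfl⟩, h⟩ := Submodule.mem_sup.1 hz
    exact ⟨p, q, h⟩

/-- Each condition is transported to `G` by `i`, solved there, and brought back by `r`. This lets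
the induction continue with complements. -/
lemma IsExactOnSquares.of_retract [Lattice P] {F G : PersistenceModule K P}
    (hG : G.IsExactOnSquares) {i : F ⟶ G} {r : G ⟶ F} (h : i ≫ r = 𝟙 F) :
    F.IsExactOnSquares where
  inj {a x y} hx hy ha v hvx hvy := by
    have : (i.app a).hom v = 0 := hG.inj hx hy ha _
      (by rw [← hom_app_trans, hvx, map_zero]) (by rw [← hom_app_trans, hvy, map_zero])
    rw [← app_retract h a v, this, map_zero]
  lift {a x y b} hx hy hx' hy' ha hb p q hpq := by
    obtain ⟨w, hwx, hwy⟩ := hG.lift hx hy hx' hy' ha hb ((i.app x).hom p) ((i.app y).hom q)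
      (by rw [← hom_app_trans, ← hom_app_trans, hpq])
    exact ⟨(r.app a).hom w, by rw [← hom_app_trans, hwx, app_retract h],
      by rw [← hom_app_trans, hwy, app_retract h]⟩
  surj {x y b} hx hy hb z := by
    obtain ⟨p, q, hpq⟩ := hG.surj hx hy hb ((i.app b).hom z)
    exact ⟨(r.app x).hom p, (r.app y).hom q, by
      rw [← hom_app_trans, ← hom_app_trans, ← map_add, hpq, app_retract h]⟩

lemma isInterval_Icc [PartialOrder P] {a b : P} (h : a ≤ b) : IsInterval (Set.Icc a b) where
  nonempty := ⟨a, le_rfl, h⟩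
  ordConnected := Set.ordConnected_Icc
  zigzag x y :=
    .tail (b := ⟨a, le_rfl, h⟩) (.single (Or.inr x.2.1)) (Or.inl y.2.1)

open Classical in
/-- The structure map of the interval module of `I` from `x` to `y`, as a map of functions. -/
noncomputable def intervalMap (I : Set P) (x y : P) (s : PLift (x ∈ I) → K) : PLift (y ∈ I) → K :=
  fun _ => if hx : x ∈ I then s ⟨hx⟩ else 0

lemma intervalMap_apply {I : Set P} {x y : P} (s : PLift (x ∈ I) → K) (hx : x ∈ I)
    (hy : PLift (y ∈ I)) : intervalMap I x y s hy = s ⟨hx⟩ :=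
  dif_pos hx

lemma intervalMap_apply_of_notMem {I : Set P} {x y : P} (s : PLift (x ∈ I) → K) (hx : x ∉ I)
    (hy : PLift (y ∈ I)) : intervalMap I x y s hy = 0 :=
  dif_neg hx

open Classical in
/-- The components of the map from the interval module of `Icc a b` determined by `v`. -/
noncomputable def spanLinearMap [PartialOrder P] {F : PersistenceModule K P} {a : P} (b : P)
    (v : F.obj a) (x : P) : (PLift (x ∈ Set.Icc a b) → K) →ₗ[K] F.obj x :=
  if hx : x ∈ Set.Icc a b then
    (LinearMap.toSpanSingleton K (F.obj x) (F.trans hx.1 v)).comp (LinearMap.proj (PLift.up hx))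
  else 0

lemma spanLinearMap_apply [PartialOrder P] {F : PersistenceModule K P} {a b : P}
    (v : F.obj a) {x : P} (hx : x ∈ Set.Icc a b) (s : PLift (x ∈ Set.Icc a b) → K) :
    spanLinearMap b v x s = s ⟨hx⟩ • F.trans hx.1 v := by
  simp [spanLinearMap, dif_pos hx]

lemma spanLinearMap_apply_of_notMem [PartialOrder P] {F : PersistenceModule K P} {a b : P}
    (v : F.obj a) {x : P} (hx : x ∉ Set.Icc a b) (s : PLift (x ∈ Set.Icc a b) → K) :
    spanLinearMap b v x s = 0 := by
  simp [spanLinearMap, dif_neg hx]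

/-- An element `v` of `F a` dying outside `Icc a b` determines a map from the interval module of
`Icc a b` to `F`. -/
noncomputable def ofIcc [PartialOrder P] {F : PersistenceModule K P} {a b : P} (v : F.obj a)
    (hv : ∀ x (h : a ≤ x), ¬ x ≤ b → F.trans h v = 0) :
    intervalModule K (Set.Icc a b) Set.ordConnected_Icc ⟶ F where
  app x := ModuleCat.ofHom (spanLinearMap b v x)
  naturality x y f := by
    refine ModuleCat.hom_ext (LinearMap.ext ?_)
    change ∀ s : PLift (x ∈ Set.Icc a b) → K,
      spanLinearMap b v y (intervalMap (Set.Icc a b) x y s) =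
        F.trans (leOfHom f) (spanLinearMap b v x s)
    intro s
    by_cases hy : y ∈ Set.Icc a b
    · rw [spanLinearMap_apply v hy]
      by_cases hx : x ∈ Set.Icc a b
      · rw [spanLinearMap_apply v hx, map_smul, trans_trans, intervalMap_apply s hx]
      · rw [spanLinearMap_apply_of_notMem v hx, intervalMap_apply_of_notMem s hx,
          zero_smul, map_zero]
    · rw [spanLinearMap_apply_of_notMem v hy]
      by_cases hx : x ∈ Set.Icc a b
      · have hay := hx.1.trans (leOfHom f)
        rw [spanLinearMap_apply v hx, map_smul, trans_trans, hv y hay fun h => hy ⟨hay, h⟩,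
          smul_zero]
      · rw [spanLinearMap_apply_of_notMem v hx, map_zero]

/-- A functional on `F b` vanishing on what comes from outside `Icc a b` determines a map from `F`
to the interval module of `Icc a b`. -/
noncomputable def toIcc [PartialOrder P] {F : PersistenceModule K P} {a b : P}
    (l : F.obj b →ₗ[K] K) (hl : ∀ x (h : x ≤ b), ¬ a ≤ x → ∀ w, l (F.trans h w) = 0) :
    F ⟶ intervalModule K (Set.Icc a b) Set.ordConnected_Icc where
  app x := ModuleCat.ofHom (LinearMap.pi fun hx => l.comp (F.trans hx.down.2))
  naturality x y f := by
    refine ModuleCat.hom_ext (LinearMap.ext fun w => funext fun hy => ?_)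
    change l (F.trans hy.down.2 (F.trans (leOfHom f) w)) =
      intervalMap (Set.Icc a b) x y (fun hx => l (F.trans hx.down.2 w)) hy
    have hxb := (leOfHom f).trans hy.down.2
    rw [trans_trans]
    by_cases hx : x ∈ Set.Icc a b
    · rw [intervalMap_apply _ hx]
    · rw [intervalMap_apply_of_notMem _ hx, hl x hxb fun h => hx ⟨h, hxb⟩]

lemma ofIcc_comp_toIcc [PartialOrder P] {F : PersistenceModule K P} {a b : P}
    (hab : a ≤ b) (v : F.obj a) (l : F.obj b →ₗ[K] K)
    (hv : ∀ x (h : a ≤ x), ¬ x ≤ b → F.trans h v = 0)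
    (hl : ∀ x (h : x ≤ b), ¬ a ≤ x → ∀ w, l (F.trans h w) = 0)
    (hlv : l (F.trans hab v) = 1) : ofIcc v hv ≫ toIcc l hl = 𝟙 _ := by
  refine NatTrans.ext (funext fun x => ModuleCat.hom_ext (LinearMap.ext ?_))
  change ∀ s : PLift (x ∈ Set.Icc a b) → K,
    (fun hx : PLift (x ∈ Set.Icc a b) => l (F.trans hx.down.2 (spanLinearMap b v x s))) = s
  intro s
  funext hx
  rw [spanLinearMap_apply v hx.down, map_smul, trans_trans, map_smul, hlv, smul_eq_mul, mul_one]

/-- `F` has the interval module of a nonempty `Icc a b` as a retract. -/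
def HasIccRetract [PartialOrder P] (F : PersistenceModule K P) : Prop :=
  ∃ a b : P, a ≤ b ∧ ∃ (i : intervalModule K (Set.Icc a b) Set.ordConnected_Icc ⟶ F)
    (r : F ⟶ intervalModule K (Set.Icc a b) Set.ordConnected_Icc), i ≫ r = 𝟙 _

/-- Some functional kills `W` but not the image of `v`; rescaled to take the value 1 there, it gives
the retraction. -/
lemma hasIccRetract_of_notMem [PartialOrder P] {F : PersistenceModule K P} {a b : P}
    (hab : a ≤ b) (v : F.obj a) (W : Submodule K (F.obj b))
    (hv : ∀ x (h : a ≤ x), ¬ x ≤ b → F.trans h v = 0)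
    (hW : ∀ x (h : x ≤ b), ¬ a ≤ x → ∀ w, F.trans h w ∈ W)
    (hvW : F.trans hab v ∉ W) : F.HasIccRetract := by
  obtain ⟨l, hlv, hl⟩ := Submodule.exists_le_ker_of_notMem hvW
  refine ⟨a, b, hab, _, _, ofIcc_comp_toIcc hab v ((l (F.trans hab v))⁻¹ • l) hv
    (fun x h hx w => ?_) ?_⟩
  · rw [LinearMap.smul_apply, LinearMap.mem_ker.1 (hl (hW x h hx w)), smul_zero]
  · simp [hlv]

lemma exists_complement [PartialOrder P] {X F : PersistenceModule K P} {i : X ⟶ F} {r : F ⟶ X}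
    (h : i ≫ r = 𝟙 X) : ∃ (G : PersistenceModule K P) (j : G ⟶ F) (q : F ⟶ G),
      j ≫ q = 𝟙 G ∧ i ≫ q = 0 ∧ Nonempty (F ≅ X ⨿ G) := by
  have : IsSplitMono i := ⟨⟨r, h⟩⟩
  let b := binaryBiconeOfIsSplitMonoOfCokernel (cokernelIsCokernel i)
  have hb : b.IsBilimit := isBilimitBinaryBiconeOfIsSplitMonoOfCokernel (cokernelIsCokernel i)
  exact ⟨cokernel i, b.inr, b.snd, b.inr_snd, b.inl_snd,
    ⟨hb.isColimit.coconePointUniqueUpToIso (colimit.isColimit _)⟩⟩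

lemma nonempty_coprod_iso_sigma {C : Type*} [Category C] [HasFiniteCoproducts C] {n : ℕ}
    (f : Fin (n + 1) → C) {F G : C} (e : F ≅ f 0 ⨿ G) (e' : G ≅ ∐ fun k : Fin n => f k.succ) :
    Nonempty (F ≅ ∐ f) :=
  ⟨e ≪≫ coprod.mapIso (Iso.refl _) e' ≪≫
    (extendCofanIsColimit f (coproductIsCoproduct fun k : Fin n => f k.succ)
      (coprodIsCoprod (f 0) (∐ fun k : Fin n => f k.succ))).coconePointUniqueUpToIso
      (coproductIsCoproduct f)⟩

lemma isZero_of_subsingleton [PartialOrder P] {F : PersistenceModule K P}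
    (h : ∀ x, Subsingleton (F.obj x)) : IsZero F :=
  Functor.isZero _ fun _ => ModuleCat.isZero_of_subsingleton _

/-- A class of pointwise finite-dimensional modules that is closed under retracts, and whose
nonzero members have interval modules as retracts, consists of interval decomposable modules. -/
lemma isIntervalDecomposable_of_hasIccRetract [PartialOrder P] [Finite P]
    (Q : PersistenceModule K P → Prop)
    (hQ : ∀ {F G : PersistenceModule K P} (i : F ⟶ G) (r : G ⟶ F), i ≫ r = 𝟙 F → Q G → Q F)
    (hQ' : ∀ F : PersistenceModule K P, Q F → (∃ x, Nontrivial (F.obj x)) → F.HasIccRetract)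
    (F : PersistenceModule K P) (hfin : F.IsPFD) (hF : Q F) : F.IsIntervalDecomposable := by
  have := Fintype.ofFinite P
  suffices H : ∃ (n : ℕ) (I : Fin n → Set P) (hI : ∀ b, IsInterval (I b)),
      Nonempty (F ≅ ∐ fun b => intervalModule K (I b) (hI b).ordConnected) by
    obtain ⟨n, I, hI, ⟨e⟩⟩ := H
    exact ⟨ULift (Fin n), fun b => I b.down, fun b => hI b.down,
      ⟨e ≪≫ Sigma.whiskerEquiv (g := fun b : ULift (Fin n) =>
        intervalModule K (I b.down) (hI b.down).ordConnected) Equiv.ulift.symm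
        fun _ => Iso.refl _⟩⟩
  induction hn : ∑ x, Module.finrank K (F.obj x) using Nat.strong_induction_on generalizing F with
  | _ n ih =>
  by_cases hF0 : ∃ x, Nontrivial (F.obj x)
  · obtain ⟨a, b, hab, i, r, hir⟩ := hQ' F hF hF0
    obtain ⟨G, j, q, hjq, hiq, ⟨e⟩⟩ := exists_complement hir
    have hj : ∀ x, Function.Injective (j.app x).hom :=
      fun x => Function.LeftInverse.injective (app_retract hjq x)
    have hG : G.IsPFD := fun x => by
      have := hfin x
      exact Module.Finite.of_injective _ (hj x)
    have hlt : ∑ x, Module.finrank K (G.obj x) < ∑ x, Module.finrank K (F.obj x) := by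
      refine Finset.sum_lt_sum (fun x _ => ?_) ⟨a, Finset.mem_univ _, ?_⟩
      · have := hfin x
        exact LinearMap.finrank_le_finrank_of_injective (hj x)
      · have := hfin a
        have := hG a
        -- With equal dimensions `q` would be injective at `a`, so `i ≫ q = 0` would make `i` zero
        -- there, although it is split mono on a nonzero space.
        refine lt_of_le_of_ne (LinearMap.finrank_le_finrank_of_injective (hj a)) fun heq => ?_
        have hqj : Function.Injective (q.app a).hom :=
          (LinearMap.injective_iff_surjective_of_finrank_eq_finrank heq.symm).2
            (Function.RightInverse.surjective (app_retract hjq a))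
        let s : PLift (a ∈ Set.Icc a b) → K := fun _ => 1
        have h0 : (i.app a).hom s = 0 := hqj <| by
          rw [map_zero]
          exact congrArg (fun f => (f.app a).hom s) hiq
        have h1 := app_retract hir a s
        rw [h0, map_zero] at h1
        exact zero_ne_one (congrFun h1 ⟨le_rfl, hab⟩)
    obtain ⟨m, I, hI, ⟨e'⟩⟩ := ih _ (hn ▸ hlt) G hG (hQ j q hjq hF) rfl
    exact ⟨m + 1, Fin.cons (Set.Icc a b) I, Fin.cases (isInterval_Icc hab) hI,
      nonempty_coprod_iso_sigma _ e e'⟩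
  · refine ⟨0, Fin.elim0, fun b => b.elim0, ⟨IsZero.iso (isZero_of_subsingleton fun x => ?_) ?_⟩⟩
    · exact not_nontrivial_iff_subsingleton.1 fun h => hF0 ⟨x, h⟩
    · exact (IsZero.iff_id_eq_zero _).2 (Sigma.hom_ext _ _ fun b => b.elim0)

end General

/-! ### Products of bounded chains: finding a retract -/

section Grid

variable {K : Type u} [Field K] {ι : Type v} [DecidableEq ι] {S : ι → Type w}
  [∀ i, LinearOrder (S i)] [∀ i, BoundedOrder (S i)]

lemma le_update_top_iff {x : ∀ i, S i} {i : ι} {m : S i} :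
    x ≤ Function.update ⊤ i m ↔ x i ≤ m := by
  simp [le_update_iff]

lemma update_bot_le_iff {x : ∀ i, S i} {i : ι} {s : S i} :
    Function.update ⊥ i s ≤ x ↔ s ≤ x i := by
  simp [update_le_iff]

/-- With the next lemma, this gives the bicartesian squares that compare the `i`-th axis with the
tops of the slabs at the same levels. -/
lemma update_bot_inf_update_top {i : ι} {s m : S i} (h : m ≤ s) :
    (Function.update ⊥ i s ⊓ Function.update ⊤ i m : ∀ i, S i) = Function.update ⊥ i m := by
  ext j
  obtain rfl | hj := eq_or_ne j i
  · simpa using h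
  · simp [hj]

lemma update_bot_sup_update_top {i : ι} {s m : S i} (h : m ≤ s) :
    (Function.update ⊥ i s ⊔ Function.update ⊤ i m : ∀ i, S i) = Function.update ⊤ i s := by
  ext j
  obtain rfl | hj := eq_or_ne j i
  · simpa using h
  · simp [hj]

lemma piecewise_insert_bot (J : Finset ι) (i : ι) (x : ∀ i, S i) :
    J.piecewise x ⊥ ⊔ Function.update ⊥ i (x i) = (insert i J).piecewise x ⊥ := by
  ext j
  obtain rfl | hj := eq_or_ne j i
  · by_cases h : j ∈ J <;> simp [h]
  · by_cases h : j ∈ J <;> simp [h, hj]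

lemma piecewise_inf_update_bot {J : Finset ι} {i : ι} (hi : i ∉ J) (x : ∀ i, S i) :
    J.piecewise x ⊥ ⊓ Function.update ⊥ i (x i) = ⊥ := by
  ext j
  obtain rfl | hj := eq_or_ne j i
  · simp [hi]
  · simp [hj]

variable {F : PersistenceModule K (∀ i, S i)}

/-- A point is the join of its projections to the axes, and the value at a join is spanned by the
values at the joined points. -/
lemma IsExactOnSquares.eq_zero_of_axes (hF : F.IsExactOnSquares) (hbot : ∀ v : F.stalk ⊥, v = 0)
    (hax : ∀ (i : ι) (s : S i) (v : F.stalk (Function.update ⊥ i s)), v = 0) (x : ∀ i, S i)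
    (J : Finset ι) (v : F.stalk (J.piecewise x ⊥)) : v = 0 := by
  induction J using Finset.induction_on with
  | empty =>
    have h : (∅ : Finset ι).piecewise x ⊥ = ⊥ := Finset.piecewise_empty _ _
    -- Structure maps along both inequalities replace a cast along `h`.
    rw [← trans_refl le_rfl v, ← trans_trans h.le h.ge v, hbot (F.trans h.le v), map_zero]
  | insert i J hi ih =>
    have hb := piecewise_insert_bot J i x
    obtain ⟨p, q, h⟩ := hF.surj (hb ▸ le_sup_left) (hb ▸ le_sup_right) hb v
    rw [← h, ih p, hax i _ q, map_zero, map_zero, add_zero]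

/-- If `v` dies at the join, its image at the `J`-part and 0 on the axis `i` lift to a common vector
at `⊥`. Injectivity along the axis makes that vector 0, so `v` already dies at the `J`-part. -/
lemma IsExactOnSquares.eq_zero_of_trans_axes (hF : F.IsExactOnSquares) (x : ∀ i, S i)
    (hax : ∀ (i : ι) (v : F.stalk ⊥),
      F.trans (bot_le : ⊥ ≤ Function.update ⊥ i (x i)) v = 0 → v = 0)
    (J : Finset ι) (v : F.stalk ⊥) (hv : F.trans (bot_le : ⊥ ≤ J.piecewise x ⊥) v = 0) : v = 0 := by
  induction J using Finset.induction_on generalizing v with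
  | empty =>
    have h : (∅ : Finset ι).piecewise x ⊥ = ⊥ := Finset.piecewise_empty _ _
    rw [← trans_refl le_rfl v, ← trans_trans bot_le h.le v, hv, map_zero]
  | insert i J hi ih =>
    have hb := piecewise_insert_bot J i x
    obtain ⟨w, hw, hw'⟩ := hF.lift bot_le bot_le (hb ▸ le_sup_left) (hb ▸ le_sup_right)
      (piecewise_inf_update_bot hi x) hb (F.trans bot_le v) 0 (by rw [trans_trans, hv, map_zero])
    have hw0 := hax i w hw'
    rw [hw0, map_zero] at hw
    exact ih v hw.symm

lemma exists_last_nonzero [∀ i, Finite (S i)] {i : ι} {s : S i}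
    {v : F.stalk (Function.update ⊥ i s)} (hv : v ≠ 0) :
    ∃ (m : S i) (h : Function.update ⊥ i s ≤ Function.update ⊥ i m), F.trans h v ≠ 0 ∧
      ∀ (x : ∀ i, S i) (h : Function.update ⊥ i s ≤ x), m < x i → F.trans h v = 0 := by
  let T : Set (S i) :=
    {m | ∃ h : Function.update ⊥ i s ≤ Function.update ⊥ i m, F.trans h v ≠ 0}
  obtain ⟨m, ⟨h, hm⟩, hmax⟩ := T.toFinite.exists_maximal ⟨s, le_rfl, by rwa [trans_refl]⟩
  -- The map to `x` factors through the axis point at level `x i`, beyond the last level `m`.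
  refine ⟨m, h, hm, fun x hx hlt => ?_⟩
  have h1 : Function.update ⊥ i s ≤ Function.update ⊥ i (x i) :=
    update_le_update_iff'.2 (update_bot_le_iff.1 hx)
  have h2 : F.trans h1 v = 0 := by
    by_contra h0
    exact (hmax ⟨h1, h0⟩ hlt.le).not_gt hlt
  rw [← trans_trans h1 (update_bot_le_iff.2 le_rfl), h2, map_zero]

lemma IsExactOnSquares.hasIccRetract_of_axis [∀ i, Finite (S i)] (hF : F.IsExactOnSquares)
    (hbot : ∀ v : F.stalk ⊥, v = 0) {i : ι} {t : S i} {v₀ : F.stalk (Function.update ⊥ i t)}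
    (hv₀ : v₀ ≠ 0) : F.HasIccRetract := by
  let T : Set (S i) := {s | ∃ v : F.stalk (Function.update ⊥ i s), v ≠ 0}
  obtain ⟨s, ⟨v, hv⟩, hmin⟩ := T.toFinite.exists_minimal ⟨t, v₀, hv₀⟩
  have hlt : ∀ r < s, ∀ w : F.stalk (Function.update ⊥ i r), w = 0 := fun r hr w => by
    by_contra h0
    exact (hmin ⟨w, h0⟩ hr.le).not_gt hr
  have hs : ⊥ < s := bot_lt_iff_ne_bot.2 fun h => by
    have h : Function.update ⊥ i s = (⊥ : ∀ i, S i) := by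
      rw [h]; exact Function.update_eq_self i _
    exact hv (by rw [← trans_refl le_rfl v, ← trans_trans h.le h.ge v, hbot (F.trans h.le v),
      map_zero])
  -- `r` is the predecessor of `s`: whatever lies below `b` but not above `a` factors through the
  -- slab top at level `r`.
  obtain ⟨r, hr, hrmax⟩ := (Set.Iio s).toFinite.exists_maximal ⟨⊥, hs⟩
  obtain ⟨m, hsm, hm, hdie⟩ := exists_last_nonzero hv
  have hsm' : s ≤ m := by simpa using update_bot_le_iff.1 hsm
  have hrm : r ≤ m := hr.le.trans hsm'
  have hmb : Function.update ⊥ i m ≤ (Function.update ⊤ i m : ∀ i, S i) := by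
    simp [le_update_top_iff]
  have hrb : Function.update ⊤ i r ≤ (Function.update ⊤ i m : ∀ i, S i) := by
    simpa [le_update_top_iff] using hrm
  refine hasIccRetract_of_notMem (hsm.trans hmb) v (LinearMap.range (F.trans hrb))
    (fun x h hx => hdie x h (by rwa [le_update_top_iff, not_le] at hx)) (fun x h hx w => ?_) ?_
  · rw [update_bot_le_iff, not_le] at hx
    have hxr : x ≤ Function.update ⊤ i r := le_update_top_iff.2
      ((le_total (x i) r).elim id fun h => hrmax hx h)
    exact ⟨F.trans hxr w, trans_trans _ _ _⟩
  · rintro ⟨w, hw⟩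
    -- An image of `v` coming from that slab top would lift to the axis at level `r`, where `F`
    -- vanishes by minimality of `s`.
    obtain ⟨u, hu, -⟩ := hF.lift (a := Function.update ⊥ i r)
      (by rw [← update_bot_inf_update_top hrm]; exact inf_le_left)
      (by rw [← update_bot_inf_update_top hrm]; exact inf_le_right) hmb hrb
      (update_bot_inf_update_top hrm) (update_bot_sup_update_top hrm) (F.trans hsm v) w
      (by rw [hw, trans_trans])
    rw [hlt r hr u, map_zero] at hu
    exact hm hu.symm

lemma IsExactOnSquares.hasIccRetract_of_trans_axis_eq_zero [∀ i, Finite (S i)]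
    (hF : F.IsExactOnSquares) {i : ι} {v : F.stalk ⊥} (hv : v ≠ 0)
    (hv' : F.trans (bot_le : ⊥ ≤ Function.update ⊥ i ⊤) v = 0) : F.HasIccRetract := by
  have hbot : Function.update ⊥ i ⊥ = (⊥ : ∀ i, S i) := Function.update_eq_self i _
  have hw : F.trans hbot.ge v ≠ 0 := fun h => hv <| by
    rw [← trans_refl le_rfl v, ← trans_trans hbot.ge hbot.le v, h, map_zero]
  obtain ⟨m, h0m, hm, hdie⟩ := exists_last_nonzero hw
  rw [trans_trans] at hm
  refine hasIccRetract_of_notMem (bot_le : ⊥ ≤ Function.update ⊤ i m) v ⊥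
    (fun x h hx => ?_) (fun x h hx => absurd bot_le hx) ?_
  · have := hdie x (hbot.le.trans h) (by rwa [le_update_top_iff, not_le] at hx)
    rwa [trans_trans] at this
  · rw [Submodule.mem_bot]
    intro h
    -- The axis point at level `m` is the meet of the end of the axis, where `v` dies, and the slab
    -- top, so `v` cannot die at the latter too.
    refine hm (hF.inj (y := Function.update ⊤ i m) (update_le_update_iff'.2 le_top)
      (by simp [le_update_top_iff]) (update_bot_inf_update_top le_top) _ ?_ ?_)
    · rw [trans_trans, hv']
    · rw [trans_trans, h]

lemma IsExactOnSquares.hasIccRetract [Finite ι] [∀ i, Finite (S i)] (hF : F.IsExactOnSquares)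
    (hF0 : ∃ x, Nontrivial (F.stalk x)) : F.HasIccRetract := by
  have := Fintype.ofFinite ι
  by_cases hbot : ∀ v : F.stalk ⊥, v = 0
  · by_cases hax : ∀ (i : ι) (s : S i) (v : F.stalk (Function.update ⊥ i s)), v = 0
    · obtain ⟨x, hx⟩ := hF0
      obtain ⟨v, hv⟩ := exists_ne (0 : F.stalk x)
      have h : Finset.univ.piecewise x ⊥ = x := Finset.piecewise_univ _ _
      refine absurd ?_ hv
      rw [← trans_refl le_rfl v, ← trans_trans h.ge h.le v,
        hF.eq_zero_of_axes hbot hax x _ (F.trans h.ge v), map_zero]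
    · push Not at hax
      obtain ⟨i, s, v, hv⟩ := hax
      exact hF.hasIccRetract_of_axis hbot hv
  · push Not at hbot
    obtain ⟨v, hv⟩ := hbot
    by_cases htop : F.trans (bot_le : ⊥ ≤ ⊤) v = 0
    · by_cases hax : ∀ (i : ι) (v : F.stalk ⊥),
        F.trans (bot_le : ⊥ ≤ Function.update ⊥ i ⊤) v = 0 → v = 0
      · have h : Finset.univ.piecewise (⊤ : ∀ i, S i) ⊥ = ⊤ := Finset.piecewise_univ _ _
        refine absurd (hF.eq_zero_of_trans_axes ⊤ hax Finset.univ v ?_) hv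
        rw [← trans_trans bot_le h.ge v, htop, map_zero]
      · push Not at hax
        obtain ⟨i, w, hw, hw0⟩ := hax
        exact hF.hasIccRetract_of_trans_axis_eq_zero hw0 hw
    · exact hasIccRetract_of_notMem bot_le v ⊥ (fun x h hx => absurd le_top hx)
        (fun x h hx => absurd bot_le hx) htop

end Grid

end PersistenceModule

theorem mainTheorem5 {K : Type u} [Field K] {ι : Type v} [Finite ι] (S : ι → Type w)
    [∀ i, LinearOrder (S i)] [∀ i, Finite (S i)]
    (F : PersistenceModule K (∀ i, S i)) (hfin : F.IsPFD) (hF : F.IsBidegreeOne) :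
    F.IsIntervalDecomposable := by
  classical
  refine PersistenceModule.isIntervalDecomposable_of_hasIccRetract
    PersistenceModule.IsExactOnSquares (fun i r h hG => hG.of_retract h) (fun G hG hG0 => ?_)
    F hfin hF.isExactOnSquares
  obtain ⟨x, hx⟩ := hG0
  -- A point with nonzero stalk makes every chain nonempty, hence bounded.
  have : ∀ i, Nonempty (S i) := fun i => ⟨x i⟩
  have : ∀ i, Fintype (S i) := fun i => Fintype.ofFinite _
  let _ : ∀ i, BoundedOrder (S i) := fun i => Fintype.toBoundedOrder (S i)
  exact hG.hasIccRetract ⟨x, hx⟩
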